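/- Call an even lattice $S$ (a finitely generated free abelian group with an integral symmetric bilinear form, all squares even) with a distinguished vector $h\in S$ \emph{polarized} if $S$ is non-degenerate with $\sigma_+(S)=1$ and $h^2>0$. For $r\in\mathbb{N}$ put $\operatorname{root}_r(S,h)=\{e\in S : e^2=-2,\ e\cdot h=r\}$. A polarized lattice $S\ni h$ is \emph{admissible} if there is no $e\in S$ with $e^2=-2$, $e\cdot h=0$, and no $e\in S$ with $e^2=0$, $e\cdot h=2$; it is \emph{geometric} if, moreover, it admits a primitive isometric embedding into the K3-lattice $2\mathbf{E}_8\oplus 3\mathbf{U}$ (with $\mathbf{E}_8$ negative definite and $\mathbf{U}$ the hyperbolic plane). For $\Gamma\subset\operatorname{root}_d(S,h)$, an admissible (respectively, geometric) lattice $S\ni h$ is \emph{$\Gamma$-admissible} (respectively, \emph{$\Gamma$-geometric}) if for no $1\le r<d$ there is a vector $e\in\operatorname{root}_r(S,h)$ with $e\cdot v<0$ for some $v\in\Gamma$. For a finite loop-free multigraph $\Gamma$ and integers $n,d>0$ let $$\mathcal{F}^d_{2n}(\Gamma):=(\mathbb{Z}\Gamma+\mathbb{Z}h)/\ker,$$ where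 $\mathbb{Z}\Gamma+\mathbb{Z}h$ is freely generated by the vertices of $\Gamma$ and $h$, with $v^2=-2$ and $h\cdot v=d$ for each vertex $v$, $u\cdot v$ equal to the multiplicity of the edge joining $u$ and $v$ for $u\ne v$ (equal to $0$ if there is no edge), and $h^2=2n$, and where $\ker$ is the radical of the form. The graph $\Gamma$ is \emph{subgeometric in degree $2n$ with respect to $d$} if $\mathcal{F}^d_{2n}(\Gamma)$ is $\Gamma$-admissible and has a $\Gamma$-geometric even finite index extension (with the same $h$). \textbf{Proposition.} For every odd integer $d>1$ there is an integer $N=N(d)$ such that, for every odd integer $n\ge N$, the graph $\Gamma:=5\tilde{A}_3+A_2$, i.e. the disjoint union of five $4$-cycles and one pair of vertices joined by a simple edge, is not subgeometric in degree $2n$ with respect to $d$. -/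

import Mathlib

/-! ## Even lattices -/

/-- An even lattice: a finitely generated free abelian group with a symmetric integral bilinear
form (possibly degenerate) all of whose squares are even. -/
structure EvenLattice where
  /-- the underlying abelian group -/
  carrier : Type
  [addCommGroup : AddCommGroup carrier]
  [free : Module.Free ℤ carrier]
  [finite : Module.Finite ℤ carrier]
  /-- the bilinear form `x · y` -/
  form : LinearMap.BilinForm ℤ carrier
  symm : ∀ x y, form x y = form y x
  even : ∀ x, Even (form x x)

namespace EvenLattice

instance : CoeSort EvenLattice Type := ⟨EvenLattice.carrier⟩

attribute [instance] addCommGroup free finite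

/-- The positive inertia index `σ₊(S)`, i.e. the maximal dimension of a positive definite subspace
of `S ⊗ ℝ`. -/
noncomputable def sigmaPos (S : EvenLattice) : ℕ :=
  sigPos (LinearMap.BilinForm.baseChange ℝ S.form).toQuadraticMap

/-- A bilinear form given by a symmetric matrix with even diagonal is even. -/
theorem even_toBilin' {ι : Type} [Fintype ι] [DecidableEq ι] (A : Matrix ι ι ℤ)
    (hA : A.IsSymm) (hd : ∀ i, Even (A i i)) (x : ι → ℤ) : Even (Matrix.toBilin' A x x) := by
  have hs : ∀ x y, Matrix.toBilin' A x y = Matrix.toBilin' A y x := by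
    intro x y
    rw [Matrix.toBilin'_apply', Matrix.toBilin'_apply', Matrix.dotProduct_mulVec,
      dotProduct_comm, ← Matrix.mulVec_transpose, hA.eq]
  have hx : x ∈ Submodule.span ℤ (Set.range (Pi.basisFun ℤ ι)) := by
    rw [Module.Basis.span_eq]; trivial
  induction hx using Submodule.span_induction with
  | mem y hy =>
    obtain ⟨i, rfl⟩ := hy
    simpa [Matrix.toBilin'_single] using hd i
  | zero => simp
  | add y z _ _ hy hz =>
    have : Matrix.toBilin' A (y + z) (y + z) = Matrix.toBilin' A y y + Matrix.toBilin' A z z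
        + (Matrix.toBilin' A y z + Matrix.toBilin' A y z) := by
      simp only [map_add, LinearMap.add_apply]
      rw [hs z y]; ring
    rw [this]
    exact (hy.add hz).add ⟨_, rfl⟩
  | smul a y _ hy =>
    simp only [map_smul, LinearMap.smul_apply, smul_eq_mul]
    exact (hy.mul_left a).mul_left a

/-- The lattice `ℤ^ι` with Gram matrix `A`. -/
noncomputable def ofGram {ι : Type} [Fintype ι] [DecidableEq ι] (A : Matrix ι ι ℤ)
    (hA : A.IsSymm) (hd : ∀ i, Even (A i i)) : EvenLattice where
  carrier := ι → ℤ
  form := Matrix.toBilin' A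
  symm x y := by
    rw [Matrix.toBilin'_apply', Matrix.toBilin'_apply', Matrix.dotProduct_mulVec,
      dotProduct_comm, ← Matrix.mulVec_transpose, hA.eq]
  even := even_toBilin' A hA hd

/-- The radical `S^⊥` of the form. -/
def radical (S : EvenLattice) : Submodule ℤ S := LinearMap.ker S.form

theorem form_isRefl (S : EvenLattice) : LinearMap.IsRefl S.form :=
  fun x y h => by rw [S.symm y x]; exact h

/-- The quotient `S / ker` of a lattice by its radical, with the induced form. -/
noncomputable def modRadical (S : EvenLattice) : EvenLattice where
  carrier := S ⧸ S.radical
  free := Module.Free.of_equiv (LinearMap.quotKerEquivRange S.form).symm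
  finite := inferInstance
  form := LinearMap.IsRefl.liftQ₂ S.form S.radical S.form_isRefl le_rfl
  symm := by
    rintro ⟨x⟩ ⟨y⟩
    exact S.symm x y
  even := by
    rintro ⟨x⟩
    exact S.even x

/-- The Gram matrix of `2E₈ ⊕ 3U`, with `E₈` negative definite and `U` the hyperbolic plane. -/
def k3Gram : Matrix ((Fin 8 × Fin 2) ⊕ (Fin 2 × Fin 3)) ((Fin 8 × Fin 2) ⊕ (Fin 2 × Fin 3)) ℤ :=
  Matrix.fromBlocks (Matrix.blockDiagonal fun _ => -CartanMatrix.E₈) 0 0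
    (Matrix.blockDiagonal fun _ => !![0, 1; 1, 0])

/-- The K3-lattice `2E₈ ⊕ 3U`. -/
noncomputable def K3 : EvenLattice :=
  ofGram k3Gram (by decide) (by decide)

/-- `f : S → L` is a primitive isometry: it is injective, preserves the form and its image is a
primitive subgroup, i.e. `L / f(S)` is torsion free. -/
structure IsPrimitiveIsometry {S L : EvenLattice} (f : S →ₗ[ℤ] L) : Prop where
  injective : Function.Injective f
  isometry : ∀ x y, L.form (f x) (f y) = S.form x y
  primitive : ∀ (m : ℤ) (y : L), m ≠ 0 → m • y ∈ LinearMap.range f → y ∈ LinearMap.range f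

/-- `f : S → S'` exhibits `S'` as a finite index extension of `S`: it is injective, preserves the
form and its image has finite index. -/
structure IsFiniteIndexExtension {S S' : EvenLattice} (f : S →ₗ[ℤ] S') : Prop where
  injective : Function.Injective f
  isometry : ∀ x y, S'.form (f x) (f y) = S.form x y
  finiteIndex : (LinearMap.range f).toAddSubgroup.FiniteIndex

/-! ## Polarized, admissible and geometric lattices -/

/-- `S ∋ h` is a polarized lattice: `S` is non-degenerate and hyperbolic, and `h² > 0`. -/
structure IsPolarized (S : EvenLattice) (h : S) : Prop where
  nondegenerate : S.form.Nondegenerate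
  hyperbolic : S.sigmaPos = 1
  pos : 0 < S.form h h

/-- `root_d(S, h)`: the vectors of square `-2` and degree `d`. -/
def root (S : EvenLattice) (h : S) (d : ℕ) : Set S :=
  {r | S.form r r = -2 ∧ S.form r h = d}

/-- A polarized lattice is admissible if it contains neither exceptional divisors nor
`2`-isotropic vectors. -/
structure IsAdmissible (S : EvenLattice) (h : S) : Prop where
  polarized : S.IsPolarized h
  no_exceptional : ¬ ∃ e : S, S.form e e = -2 ∧ S.form e h = 0
  no_two_isotropic : ¬ ∃ e : S, S.form e e = 0 ∧ S.form e h = 2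

/-- An admissible lattice is geometric if it admits a primitive isometry to the K3-lattice. -/
structure IsGeometric (S : EvenLattice) (h : S) : Prop where
  admissible : S.IsAdmissible h
  embeds : ∃ f : S →ₗ[ℤ] K3, IsPrimitiveIsometry f

/-- No vector of `root_r(S, h)`, `1 ≤ r < d`, is a `Γ`-inadmissible root. -/
def NoInadmissibleRoot (S : EvenLattice) (h : S) (d : ℕ) (Γ : Set S) : Prop :=
  ∀ r : ℕ, 1 ≤ r → r < d → ¬ ∃ e ∈ S.root h r, ∃ v ∈ Γ, S.form e v < 0

/-- `S ∋ h` is `Γ`-admissible, where `Γ ⊂ root_d(S, h)`. -/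
structure IsGraphAdmissible (S : EvenLattice) (h : S) (d : ℕ) (Γ : Set S) : Prop where
  admissible : S.IsAdmissible h
  subset : Γ ⊆ S.root h d
  no_inadmissible : S.NoInadmissibleRoot h d Γ

/-- `S ∋ h` is `Γ`-geometric, where `Γ ⊂ root_d(S, h)`. -/
structure IsGraphGeometric (S : EvenLattice) (h : S) (d : ℕ) (Γ : Set S) : Prop where
  geometric : S.IsGeometric h
  subset : Γ ⊆ S.root h d
  no_inadmissible : S.NoInadmissibleRoot h d Γ

end EvenLattice

/-! ## Graphs and their lattices -/

/-- A finite loop-free multigraph; `mult u v` is the multiplicity of the edge joining `u`, `v`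
(`0` if there is no edge). -/
structure Multigraph where
  V : Type
  [fintype : Fintype V]
  [decEq : DecidableEq V]
  mult : V → V → ℕ
  symm : ∀ u v, mult u v = mult v u
  loopless : ∀ v, mult v v = 0

namespace Multigraph

attribute [instance] fintype decEq

/-- A simple graph as a multigraph with all edges of multiplicity one. -/
def ofSimpleGraph {V : Type} [Fintype V] [DecidableEq V] (G : SimpleGraph V)
    [DecidableRel G.Adj] : Multigraph where
  V := V
  mult u v := if G.Adj u v then 1 else 0
  symm u v := by simp only [G.adj_comm]
  loopless v := by simp

/-- The disjoint union of two graphs. -/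
def disjUnion (Γ Γ' : Multigraph) : Multigraph where
  V := Γ.V ⊕ Γ'.V
  mult
    | .inl u, .inl v => Γ.mult u v
    | .inr u, .inr v => Γ'.mult u v
    | _, _ => 0
  symm := by
    rintro (u | u) (v | v)
    · exact Γ.symm u v
    · rfl
    · rfl
    · exact Γ'.symm u v
  loopless := by
    rintro (v | v)
    · exact Γ.loopless v
    · exact Γ'.loopless v

/-- The disjoint union of `m` copies of a graph. -/
def copies (m : ℕ) (Γ : Multigraph) : Multigraph where
  V := Fin m × Γ.V
  mult u v := if u.1 = v.1 then Γ.mult u.2 v.2 else 0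
  symm u v := by simp only [eq_comm, Γ.symm u.2 v.2]
  loopless v := by simp [Γ.loopless]

/-- The affine Dynkin diagram `Ã₃`: the cycle on four vertices. -/
def affineA3 : Multigraph := ofSimpleGraph (SimpleGraph.cycleGraph 4)

/-- The Dynkin diagram `A₂`: two vertices joined by a simple edge. -/
def A2 : Multigraph := ofSimpleGraph (⊤ : SimpleGraph (Fin 2))

/-- The graph `5Ã₃ + A₂`. -/
def fiveAffineA3PlusA2 : Multigraph := disjUnion (copies 5 affineA3) A2

/-- The Gram matrix of `ℤΓ + ℤh` in the basis consisting of `h` (the index `none`) and the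
vertices of `Γ`: `h² = 2n`, `h · v = d`, `v² = -2`, and `u · v` is the multiplicity of the edge
joining `u` and `v`. -/
def gram (Γ : Multigraph) (n d : ℕ) : Matrix (Option Γ.V) (Option Γ.V) ℤ
  | none, none => 2 * n
  | none, some _ => d
  | some _, none => d
  | some u, some v => if u = v then -2 else Γ.mult u v

theorem gram_isSymm (Γ : Multigraph) (n d : ℕ) : (Γ.gram n d).IsSymm := by
  refine Matrix.IsSymm.ext ?_
  rintro (_ | u) (_ | v)
  · rfl
  · rfl
  · rfl
  · simp only [gram, eq_comm, Γ.symm u v]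

theorem even_gram_diag (Γ : Multigraph) (n d : ℕ) (i : Option Γ.V) : Even (Γ.gram n d i i) := by
  rcases i with _ | u
  · exact even_two_mul _
  · simp [gram]

/-- The lattice `ℤΓ + ℤh`. -/
noncomputable def preFano (Γ : Multigraph) (n d : ℕ) : EvenLattice :=
  EvenLattice.ofGram (Γ.gram n d) (Γ.gram_isSymm n d) (Γ.even_gram_diag n d)

/-- The lattice `(ℤΓ + ℤh) / ker` with `h² = 2n` and `h · v = d` for the vertices `v` of `Γ`. -/
noncomputable def fano (Γ : Multigraph) (n d : ℕ) : EvenLattice := (Γ.preFano n d).modRadical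

/-- The image in `(ℤΓ + ℤh) / ker` of the basis vector `i`. -/
noncomputable def fanoVec (Γ : Multigraph) (n d : ℕ) (i : Option Γ.V) : Γ.fano n d :=
  (Γ.preFano n d).radical.mkQ (Pi.single i 1 : Option Γ.V → ℤ)

/-- The polarization `h`. -/
noncomputable def fanoH (Γ : Multigraph) (n d : ℕ) : Γ.fano n d := Γ.fanoVec n d none

/-- The set of (the images of) the vertices of `Γ`. -/
def fanoVertices (Γ : Multigraph) (n d : ℕ) : Set (Γ.fano n d) :=
  Set.range fun v : Γ.V => Γ.fanoVec n d (some v)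

/-- `Γ` is admissible in degree `2n` with respect to `d`. -/
def IsAdmissible (Γ : Multigraph) (n d : ℕ) : Prop :=
  (Γ.fano n d).IsGraphAdmissible (Γ.fanoH n d) d (Γ.fanoVertices n d)

/-- `Γ` is subgeometric in degree `2n` with respect to `d`: it is admissible and
`(ℤΓ + ℤh) / ker` has a `Γ`-geometric (even) finite index extension. -/
def IsSubgeometric (Γ : Multigraph) (n d : ℕ) : Prop :=
  Γ.IsAdmissible n d ∧
    ∃ (S : EvenLattice) (f : Γ.fano n d →ₗ[ℤ] S),
      EvenLattice.IsFiniteIndexExtension f ∧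
        S.IsGraphGeometric (f (Γ.fanoH n d)) d (f '' Γ.fanoVertices n d)

end Multigraph

/-! Let `k` be the common class of the five fibers. In a subgeometric extension `S` of rank 19, the
sums `v i 1 + v i 3` represent the elements of order two in the discriminants of the five copies of
`A₃`. Together with `k` they would give too large a radical modulo 2 for a primitive sublattice of a
unimodular lattice of rank 22, unless many of them are destroyed by gluing. Gluing is limited as
follows.

For `y` orthogonal to `k`, the square is determined by the intersections with the vertices
(`exists_four_mul_sq`), so evenness restricts the discriminant classes of `y`: zero or four of them
have order four (`sum_emod_two`). If all have order at most two, the number of nonzero ones is also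
zero or four: two would produce a root joining fibers, which, after adding vertices and multiples of
`k`, becomes inadmissible (`sum_eq_zero_or_four`).

An arbitrary vector is first projected along `h`. For `d` and `n` odd, congruences modulo 8 and 16
give `4 ∣ x · k` (`four_dvd_apply_fiber`), so the projection of `d x` is integral and the weight
restriction applies to it as well (`sum_val_word`). A binary code of length five with weights 0 and
4 has dimension at most one. So at most one dimension of the six-dimensional space of candidates
fails to be orthogonal to `S` modulo 2, and at most one more is lost to divisibility by 2. At least
four remain, while the corank is 3. -/

section

open Finset Module

/-! ### The configuration and congruences for `A₃` discriminants -/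

/-- Vectors `h`, `v i j`, `a`, `b` of a lattice spanning up to finite index and intersecting as
the polarization and the vertices of `5Ã₃ + A₂`. -/
structure IsFiveA3Configuration {M : Type*} [AddCommGroup M] (B : LinearMap.BilinForm ℤ M)
    (d n : ℤ) (h : M) (v : Fin 5 → Fin 4 → M) (a b : M) : Prop where
  symm : ∀ x y, B x y = B y x
  even : ∀ x, Even (B x x)
  hh : B h h = 2 * n
  hv : ∀ i j, B h (v i j) = d
  ha : B h a = d
  hb : B h b = d
  vv : ∀ i j i' j', B (v i j) (v i' j') =
    if i = i' then (if j = j' then -2 else if j = j' + 2 then 0 else 1) else 0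
  va : ∀ i j, B (v i j) a = 0
  vb : ∀ i j, B (v i j) b = 0
  aa : B a a = -2
  bb : B b b = -2
  ab : B a b = 1
  ext : ∀ x, B x h = 0 → (∀ i j, B x (v i j) = 0) → B x a = 0 → B x b = 0 → x = 0

/-- The class of a functional on `Ã₃` vanishing on the fiber in the discriminant group `ℤ/4` of
`A₃`. -/
def discrClass (p : Fin 4 → ℤ) : ℤ := p 1 + 2 * p 2 + 3 * p 3

/-- Minus four times the square of a functional on `A₃`. -/
def dualNorm (p : Fin 4 → ℤ) : ℤ :=
  3 * p 1 ^ 2 + 4 * p 2 ^ 2 + 3 * p 3 ^ 2 + 4 * p 1 * p 2 + 2 * p 1 * p 3 + 4 * p 2 * p 3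

theorem dualNorm_eq (p : Fin 4 → ℤ) :
    dualNorm p = 3 * discrClass p ^ 2
      - 8 * (p 2 ^ 2 + 3 * p 3 ^ 2 + p 1 * p 2 + 2 * p 1 * p 3 + 4 * p 2 * p 3) := by
  simp only [dualNorm, discrClass]; ring

theorem dualNorm_emod_eight (p : Fin 4 → ℤ) :
    (discrClass p % 2 = 1 ∧ dualNorm p % 8 = 3) ∨
      (discrClass p % 2 = 0 ∧ (dualNorm p % 8 = 0 ∨ dualNorm p % 8 = 4)) := by
  rw [dualNorm_eq]
  generalize p 2 ^ 2 + 3 * p 3 ^ 2 + p 1 * p 2 + 2 * p 1 * p 3 + 4 * p 2 * p 3 = r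
  rcases Int.even_or_odd' (discrClass p) with ⟨c, hc | hc⟩
  · right
    refine ⟨by omega, ?_⟩
    rw [hc, show 3 * (2 * c) ^ 2 - 8 * r = 4 * (3 * c ^ 2) - 8 * r by ring]
    omega
  · left
    refine ⟨by omega, ?_⟩
    obtain ⟨m, hm⟩ := Int.even_mul_succ_self c
    rw [hc, show 3 * (2 * c + 1) ^ 2 - 8 * r = 12 * (c * (c + 1)) + 3 - 8 * r by ring, hm]
    omega

/-- The norm of a functional that is odd on each vertex. -/
theorem dualNorm_emod_sixteen (p : Fin 4 → ℤ) (hp : ∀ j, Odd (p j)) :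
    (discrClass p % 4 = 0 ∧ dualNorm p % 16 = 8) ∨
      (discrClass p % 4 = 2 ∧ dualNorm p % 16 = 4) := by
  have h1 := Int.not_even_iff_odd.mpr (hp 1)
  have h2 := Int.not_even_iff_odd.mpr (hp 2)
  have h3 := Int.not_even_iff_odd.mpr (hp 3)
  have hE3 : ¬ Even (3 : ℤ) := by decide
  have hE4 : Even (4 : ℤ) := by decide
  -- Only the parity of this factor matters: being odd, it contributes 8 modulo 16 to the norm.
  have hr : Odd (p 2 ^ 2 + 3 * p 3 ^ 2 + p 1 * p 2 + 2 * p 1 * p 3 + 4 * p 2 * p 3) := by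
    simp [parity_simps, h1, h2, h3, hE3, hE4]
  have hc : Even (discrClass p) := by
    simp [discrClass, parity_simps, h1, h3, hE3]
  rw [dualNorm_eq]
  obtain ⟨r, hr⟩ := hr
  obtain ⟨c, hc⟩ := hc.two_dvd
  rw [hr, hc, show 3 * (2 * c) ^ 2 - 8 * (2 * r + 1) = 12 * c ^ 2 - 16 * r - 8 by ring]
  rcases Int.even_or_odd' c with ⟨m, rfl | rfl⟩
  · left
    rw [show 12 * (2 * m) ^ 2 = 16 * (3 * m ^ 2) by ring]
    omega
  · right
    rw [show 12 * (2 * m + 1) ^ 2 = 16 * (3 * m ^ 2 + 3 * m) + 12 by ring]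
    omega

/-! ### The orthogonal complement of the fiber class -/

namespace IsFiveA3Configuration

variable {M : Type*} [AddCommGroup M] {B : LinearMap.BilinForm ℤ M} {d n : ℤ} {h : M}
  {v : Fin 5 → Fin 4 → M} {a b : M}

/-- Both sums have degree `4d` and are orthogonal to all vertices, so non-degeneracy identifies
them. -/
theorem sum_fiber_eq (H : IsFiveA3Configuration B d n h v a b) (i : Fin 5) :
    ∑ j, v i j = ∑ j, v 0 j := by
  rw [← sub_eq_zero]
  refine H.ext _ ?_ ?_ ?_ ?_
  · simp [H.symm _ h, H.hv]
  · intro i' j'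
    rw [map_sub, LinearMap.sub_apply, map_sum, map_sum, LinearMap.sum_apply, LinearMap.sum_apply]
    simp only [H.vv]
    have key : ∀ i i' : Fin 5, ∀ j' : Fin 4, ∑ j : Fin 4,
        (if i = i' then (if j = j' then -2 else if j = j' + 2 then 0 else 1) else 0 : ℤ) = 0 := by
      decide
    simp [key]
  · simp [H.va]
  · simp [H.vb]

theorem fiber_apply_vertex (H : IsFiveA3Configuration B d n h v a b) (i : Fin 5) (j : Fin 4) :
    B (∑ j, v 0 j) (v i j) = 0 := by
  rw [map_sum, LinearMap.sum_apply]
  simp only [H.vv]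
  revert i j
  decide

theorem fiber_apply_a (H : IsFiveA3Configuration B d n h v a b) : B (∑ j, v 0 j) a = 0 := by
  simp [H.va]

theorem fiber_apply_b (H : IsFiveA3Configuration B d n h v a b) : B (∑ j, v 0 j) b = 0 := by
  simp [H.vb]

theorem fiber_apply_h (H : IsFiveA3Configuration B d n h v a b) : B (∑ j, v 0 j) h = 4 * d := by
  simp [H.symm _ h, H.hv]

theorem fiber_apply_fiber (H : IsFiveA3Configuration B d n h v a b) :
    B (∑ j, v 0 j) (∑ j, v 0 j) = 0 := by
  rw [map_sum (B (∑ j, v 0 j))]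
  simp only [H.fiber_apply_vertex, sum_const_zero]

theorem sum_apply_vertex (H : IsFiveA3Configuration B d n h v a b) (y : M) (i : Fin 5) :
    ∑ j, B y (v i j) = B y (∑ j, v 0 j) := by
  rw [← map_sum, H.sum_fiber_eq]

/-- An element orthogonal to the fiber and to the vertices other than the zeroth ones is
proportional to the fiber. -/
theorem apply_eq_zero_of_orthogonal (H : IsFiveA3Configuration B d n h v a b) (hd : d ≠ 0)
    {z : M} (hz : ∀ i, B z (v i 1) = 0 ∧ B z (v i 2) = 0 ∧ B z (v i 3) = 0)
    (hza : B z a = 0) (hzb : B z b = 0) (hk : B z (∑ j, v 0 j) = 0) {y : M}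
    (hy : B y (∑ j, v 0 j) = 0) : B z y = 0 := by
  have hz0 : ∀ i j, B z (v i j) = 0 := by
    intro i j
    have h1 := H.sum_apply_vertex z i
    rw [Fin.sum_univ_four, hk, (hz i).1, (hz i).2.1, (hz i).2.2] at h1
    fin_cases j
    · simpa using h1
    · exact (hz i).1
    · exact (hz i).2.1
    · exact (hz i).2.2
  -- The multiple of the fiber is chosen to cancel the degree, the only intersection of `z` that may
  -- be nonzero.
  have : (4 * d) • z - B z h • (∑ j, v 0 j) = 0 := by
    refine H.ext _ ?_ ?_ ?_ ?_
    · rw [map_sub, LinearMap.sub_apply, map_smul, map_smul, LinearMap.smul_apply,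
        LinearMap.smul_apply, H.fiber_apply_h, smul_eq_mul, smul_eq_mul]
      ring
    · intro i j
      rw [map_sub, LinearMap.sub_apply, map_smul, map_smul, LinearMap.smul_apply,
        LinearMap.smul_apply, H.fiber_apply_vertex, hz0, smul_zero, smul_zero, sub_zero]
    · rw [map_sub, LinearMap.sub_apply, map_smul, map_smul, LinearMap.smul_apply,
        LinearMap.smul_apply, H.fiber_apply_a, hza, smul_zero, smul_zero, sub_zero]
    · rw [map_sub, LinearMap.sub_apply, map_smul, map_smul, LinearMap.smul_apply,
        LinearMap.smul_apply, H.fiber_apply_b, hzb, smul_zero, smul_zero, sub_zero]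
  have h2 := congrArg (fun x => B x y) this
  simp only [map_sub, LinearMap.sub_apply, map_smul, LinearMap.smul_apply, smul_eq_mul,
    H.symm (∑ j, v 0 j) y, hy, mul_zero, sub_zero, map_zero, LinearMap.zero_apply] at h2
  rcases mul_eq_zero.mp h2 with h3 | h3
  · omega
  · exact h3

/-- The integral combination of the vertices with given coefficients. -/
def comb (v : Fin 5 → Fin 4 → M) (a b : M) (x : Fin 5 → Fin 4 → ℤ) (s t : ℤ) : M :=
  ∑ i, ∑ j, x i j • v i j + s • a + t • b

theorem apply_comb (y : M) (x : Fin 5 → Fin 4 → ℤ) (s t : ℤ) :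
    B y (comb v a b x s t) = ∑ i, ∑ j, x i j * B y (v i j) + s * B y a + t * B y b := by
  simp [comb]

theorem comb_apply_vertex (H : IsFiveA3Configuration B d n h v a b) (x : Fin 5 → Fin 4 → ℤ)
    (s t : ℤ) (i : Fin 5) (j : Fin 4) :
    B (comb v a b x s t) (v i j) = -2 * x i j + x i (j + 1) + x i (j + 3) := by
  rw [H.symm, apply_comb]
  simp only [H.vv, H.va, H.vb, mul_ite, mul_zero, add_zero]
  rw [Finset.sum_eq_single i]
  · simp only [if_true]
    rw [Fin.sum_univ_four]
    fin_cases j <;> simp <;> ring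
  · intro i' _ hi'
    simp [hi'.symm]
  · simp

theorem comb_apply_a (H : IsFiveA3Configuration B d n h v a b) (x : Fin 5 → Fin 4 → ℤ)
    (s t : ℤ) : B (comb v a b x s t) a = -2 * s + t := by
  rw [H.symm, apply_comb]
  simp [H.symm a (v _ _), H.va, H.aa, H.ab, mul_comm]

theorem comb_apply_b (H : IsFiveA3Configuration B d n h v a b) (x : Fin 5 → Fin 4 → ℤ)
    (s t : ℤ) : B (comb v a b x s t) b = s - 2 * t := by
  rw [H.symm, apply_comb]
  simp [H.symm b (v _ _), H.vb, H.bb, H.symm b a, H.ab]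
  ring

theorem comb_apply_fiber (H : IsFiveA3Configuration B d n h v a b) (x : Fin 5 → Fin 4 → ℤ)
    (s t : ℤ) : B (comb v a b x s t) (∑ j, v 0 j) = 0 := by
  rw [H.symm, apply_comb]
  simp only [H.fiber_apply_vertex, H.fiber_apply_a, H.fiber_apply_b, mul_zero, sum_const_zero,
    add_zero]

/-- The square of a vector orthogonal to the fiber in terms of its intersections with the
vertices. -/
theorem twelve_mul_sq (H : IsFiveA3Configuration B d n h v a b) (hd : d ≠ 0) {y : M}
    (hy : B y (∑ j, v 0 j) = 0) :
    12 * B y y + 3 * ∑ i, dualNorm (fun j => B y (v i j)) +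
      8 * (B y a ^ 2 + B y a * B y b + B y b ^ 2) = 0 := by
  set p : Fin 5 → Fin 4 → ℤ := fun i j => B y (v i j) with hp
  -- The coefficients are 12 times the inverse Cartan matrices of `A₃` and `A₂` applied to the
  -- intersections of `y`; hence `12 y + c` satisfies the hypotheses of
  -- `apply_eq_zero_of_orthogonal`.
  set c := comb v a b (fun i => ![0, 3 * (3 * p i 1 + 2 * p i 2 + p i 3),
    3 * (2 * p i 1 + 4 * p i 2 + 2 * p i 3), 3 * (p i 1 + 2 * p i 2 + 3 * p i 3)])
    (4 * (2 * B y a + B y b)) (4 * (B y a + 2 * B y b)) with hc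
  have hz := H.apply_eq_zero_of_orthogonal hd (z := (12 : ℤ) • y + c) (y := y) ?_ ?_ ?_ ?_ hy
  · rw [H.symm, map_add, map_smul, hc, apply_comb] at hz
    rw [← hz, Finset.mul_sum]
    simp only [Fin.sum_univ_four, dualNorm, smul_eq_mul]
    simp only [Matrix.cons_val, Matrix.cons_val_zero, Matrix.cons_val_one, hp]
    rw [add_assoc, add_assoc (Finset.sum _ _)]
    congr 2
    · refine Finset.sum_congr rfl fun i _ => ?_
      ring
    · ring
  · intro i
    simp only [map_add, LinearMap.add_apply, map_smul, LinearMap.smul_apply, hc,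
      H.comb_apply_vertex, smul_eq_mul]
    simp only [hp]
    refine ⟨?_, ?_, ?_⟩ <;> simp <;> ring
  · simp only [map_add, LinearMap.add_apply, map_smul, LinearMap.smul_apply, hc,
      H.comb_apply_a, smul_eq_mul]
    ring
  · simp only [map_add, LinearMap.add_apply, map_smul, LinearMap.smul_apply, hc,
      H.comb_apply_b, smul_eq_mul]
    ring
  · simp only [map_add, LinearMap.add_apply, map_smul, LinearMap.smul_apply, hc,
      H.comb_apply_fiber, smul_eq_mul, hy, mul_zero, add_zero]

/-- Reducing `twelve_mul_sq` modulo 3 makes the `A₂` term divisible by 3, and that term is congruent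
to `(y · a - y · b) ^ 2`. The resulting equation carries all later congruences modulo 8 and 16. -/
theorem exists_four_mul_sq (H : IsFiveA3Configuration B d n h v a b) (hd : d ≠ 0) {y : M}
    (hy : B y (∑ j, v 0 j) = 0) :
    ∃ q, B y a ^ 2 + B y a * B y b + B y b ^ 2 = 3 * q ∧ 3 ∣ B y a - B y b ∧
      4 * B y y + ∑ i, dualNorm (fun j => B y (v i j)) + 8 * q = 0 := by
  have h1 := H.twelve_mul_sq hd hy
  have h3 : (3 : ℤ) ∣ B y a ^ 2 + B y a * B y b + B y b ^ 2 := by omega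
  obtain ⟨q, hq⟩ := h3
  refine ⟨q, hq, ?_, by omega⟩
  have : (3 : ℤ) ∣ (B y a - B y b) ^ 2 := by
    refine ⟨q - B y a * B y b, ?_⟩
    linear_combination hq
  exact Int.prime_three.dvd_of_dvd_pow this

/-! ### Restrictions on gluing imposed by roots -/

/-- All roots of degree less than `d` have positive degree and intersect the vertices
non-negatively. -/
def RootCondition (B : LinearMap.BilinForm ℤ M) (d : ℤ) (h : M) (v : Fin 5 → Fin 4 → M) : Prop :=
  ∀ e, B e e = -2 → 0 ≤ B e h → B e h < d → B e h ≠ 0 ∧ ∀ i j, 0 ≤ B e (v i j)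

/-- Half a fiber has degree `2d`, the degree of two adjacent vertices together; their difference is
an exceptional root. -/
theorem ne_two_smul_fiber (H : IsFiveA3Configuration B d n h v a b) (hd : 0 < d)
    (hR : RootCondition B d h v) (y : M) : ∑ j, v 0 j ≠ (2 : ℤ) • y := by
  intro hy
  have hyv : ∀ j, B y (v 0 j) = 0 := by
    intro j
    have := H.fiber_apply_vertex 0 j
    rw [hy, map_smul, LinearMap.smul_apply, smul_eq_mul] at this
    omega
  have hyh : B y h = 2 * d := by
    have := H.fiber_apply_h
    rw [hy, map_smul, LinearMap.smul_apply, smul_eq_mul] at this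
    omega
  have hyy : B y y = 0 := by
    have := H.fiber_apply_fiber
    simp only [hy, map_smul, LinearMap.smul_apply, smul_eq_mul] at this
    omega
  have h0 : B (v 0 0 + v 0 1 - y) h = 0 := by
    simp only [map_sub, map_add, LinearMap.sub_apply, LinearMap.add_apply, H.symm _ h, H.hv]
    rw [H.symm, hyh]
    ring
  refine (hR (v 0 0 + v 0 1 - y) ?_ h0.ge (h0.trans_lt hd)).1 h0
  simp [hyv, H.symm _ y, hyy, H.vv]

theorem sq_add_smul {x k : M} (t : ℤ) (hk : B k k = 0) (hxk : B x k = 0) (hkx : B k x = 0) :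
    B (x + t • k) (x + t • k) = B x x := by
  simp [hk, hxk, hkx]

/-- There is no root joining a fiber to another component of its complement. -/
theorem not_root_joining_fiber (H : IsFiveA3Configuration B d n h v a b) (hd : 0 < d)
    (hR : RootCondition B d h v) {e : M} (he : B e e = -2) (i : Fin 5) (h0 : B e (v i 0) = -1)
    (h1 : B e (v i 1) = 0) (h2 : B e (v i 2) = 1) (h3 : B e (v i 3) = 0) : False := by
  have hk : B e (∑ j, v 0 j) = 0 := by
    rw [← H.sum_apply_vertex e i, Fin.sum_univ_four, h0, h1, h2, h3]
    rfl
  -- Adding `w` shifts the degree by `c * d` and adding `t` fibers by `4 * t * d`, so the total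
  -- shift can bring the degree into `[0, d)`. It remains to find, for each residue `c` modulo 4, a
  -- root `e + w` negative on some vertex; these arise by adding `v i 2`, `v i 1`, `v i 3` in turn.
  have key : ∀ (w : M) (c t : ℤ) (j : Fin 4), B (e + w) (e + w) = -2 → B w h = c * d →
      B (∑ j, v 0 j) w = 0 → B (e + w) (v i j) < 0 → -(B e h / d) = 4 * t + c → False := by
    intro w c t j hw hwh hwk hwv ht
    have hr : B (e + w + t • ∑ j, v 0 j) h = B e h % d := by
      rw [map_add, LinearMap.add_apply, map_add, LinearMap.add_apply, map_smul,
        LinearMap.smul_apply, H.fiber_apply_h, hwh, smul_eq_mul, Int.emod_def]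
      linear_combination (-d) * ht
    have hlt := (hR (e + w + t • ∑ j, v 0 j) ?_ (hr ▸ Int.emod_nonneg _ hd.ne')
      (hr ▸ Int.emod_lt_of_pos _ hd)).2 i j
    · rw [map_add, LinearMap.add_apply, map_smul, LinearMap.smul_apply, H.fiber_apply_vertex,
        smul_zero, add_zero] at hlt
      exact absurd hwv (not_lt.mpr hlt)
    · rw [sq_add_smul _ H.fiber_apply_fiber, hw]
      · rw [map_add, LinearMap.add_apply, hk, H.symm w, hwk, add_zero]
      · rw [map_add, H.symm _ e, hk, hwk, add_zero]
  have hkv : ∀ j, B (∑ j, v 0 j) (v i j) = 0 := H.fiber_apply_vertex i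
  have hm := Int.emod_add_mul_ediv (-(B e h / d)) 4
  have hm0 := Int.emod_nonneg (-(B e h / d)) (b := 4) (by norm_num)
  have hm4 := Int.emod_lt_of_pos (-(B e h / d)) (b := 4) (by norm_num)
  generalize -(B e h / d) % 4 = c at hm hm0 hm4
  generalize -(B e h / d) / 4 = t at hm
  interval_cases c
  · refine key 0 0 t 0 ?_ ?_ ?_ ?_ (by omega)
    · simpa using he
    · simp
    · simp
    · simp [h0]
  · refine key (v i 2) 1 t 2 ?_ ?_ ?_ ?_ (by omega)
    · simp [H.symm _ e, he, h2, H.vv]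
    · simp [H.symm _ h, H.hv]
    · simp [-map_sum, hkv]
    · simp [h2, H.vv]
  · refine key (v i 2 + v i 1) 2 t 1 ?_ ?_ ?_ ?_ (by omega)
    · simp [H.symm _ e, he, h1, h2, H.vv]
    · simp [H.symm _ h, H.hv]
      ring
    · rw [map_add, hkv, hkv, add_zero]
    · simp [h1, H.vv]
  · refine key (v i 2 + v i 1 + v i 3) 3 t 1 ?_ ?_ ?_ ?_ (by omega)
    · simp [H.symm _ e, he, h1, h2, h3, H.vv]
    · simp [H.symm _ h, H.hv]
      ring
    · rw [map_add, map_add, hkv, hkv, hkv, add_zero, add_zero]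
    · simp [h1, H.vv]

/-- A gluing vector with all components of order two involves none or four of the fibers. -/
theorem sum_eq_zero_or_four (H : IsFiveA3Configuration B d n h v a b) (hd : 0 < d)
    (hR : RootCondition B d h v) {y : M} (hy : B y (∑ j, v 0 j) = 0) (ε : Fin 5 → ℤ)
    (hε : ∀ i, ε i = 0 ∨ ε i = 1) (hc : ∀ i, 4 ∣ discrClass (fun j => B y (v i j)) - 2 * ε i) :
    ∑ i, ε i = 0 ∨ ∑ i, ε i = 4 := by
  choose m hm using hc
  obtain ⟨-, -, ⟨u, hu⟩, -⟩ := H.exists_four_mul_sq hd.ne' hy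
  -- The coefficients solve the triangular system bringing the intersections with each fiber to
  -- `(-ε, 0, ε, 0)` and those with `a`, `b` to zero; the congruences on the classes make them
  -- integral.
  set e := y + comb v a b (fun i => ![0, 3 * m i - (B y (v i 2) - ε i) - 2 * B y (v i 3),
    2 * m i - B y (v i 3), m i]) (B y b + 2 * u) (B y b + u) with he
  have hek : B e (∑ j, v 0 j) = 0 := by
    rw [he, map_add, LinearMap.add_apply, hy, H.comb_apply_fiber, add_zero]
  have he1 : ∀ i, B e (v i 1) = 0 := by
    intro i
    rw [he, map_add, LinearMap.add_apply, H.comb_apply_vertex]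
    have := hm i
    simp only [discrClass] at this
    simp
    linarith
  have he2 : ∀ i, B e (v i 2) = ε i := by
    intro i
    rw [he, map_add, LinearMap.add_apply, H.comb_apply_vertex]
    simp
    ring
  have he3 : ∀ i, B e (v i 3) = 0 := by
    intro i
    rw [he, map_add, LinearMap.add_apply, H.comb_apply_vertex]
    simp
    ring
  have he0 : ∀ i, B e (v i 0) = - ε i := by
    intro i
    have := H.sum_apply_vertex e i
    rw [hek, Fin.sum_univ_four, he1, he2, he3] at this
    linarith
  have hea : B e a = 0 := by
    rw [he, map_add, LinearMap.add_apply, H.comb_apply_a]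
    linarith
  have heb : B e b = 0 := by
    rw [he, map_add, LinearMap.add_apply, H.comb_apply_b]
    linarith
  obtain ⟨q, hq, -, hsq⟩ := H.exists_four_mul_sq hd.ne' hek
  have hN : ∀ i, dualNorm (fun j => B e (v i j)) = 4 * ε i := by
    intro i
    simp only [dualNorm, he1, he2, he3]
    rcases hε i with h | h <;> rw [h] <;> norm_num
  simp only [hN, ← Finset.mul_sum] at hsq
  rw [hea, heb] at hq
  have hee : B e e = - ∑ i, ε i := by linarith
  -- The number of ones equals `-e²`: evenness excludes 1, 3 and 5, and the absence of joining roots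
  -- excludes 2.
  obtain ⟨r, hr⟩ := H.even e
  by_cases h2 : B e e = -2
  · exfalso
    obtain ⟨i, hi⟩ : ∃ i, ε i = 1 := by
      by_contra! hne
      have : ∑ i, ε i = 0 := Finset.sum_eq_zero fun i _ => (hε i).resolve_right (hne i)
      omega
    exact H.not_root_joining_fiber hd hR h2 i (by rw [he0, hi]) (he1 i) (by rw [he2, hi]) (he3 i)
  · rw [Fin.sum_univ_five] at *
    have := hε 0
    have := hε 1
    have := hε 2
    have := hε 3
    have := hε 4
    omega

/-- A gluing vector has none or four components of order four. -/
theorem sum_emod_two (H : IsFiveA3Configuration B d n h v a b) (hd : d ≠ 0) {y : M}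
    (hy : B y (∑ j, v 0 j) = 0) :
    ∑ i, discrClass (fun j => B y (v i j)) % 2 = 0 ∨
      ∑ i, discrClass (fun j => B y (v i j)) % 2 = 4 := by
  obtain ⟨q, -, -, hsq⟩ := H.exists_four_mul_sq hd hy
  obtain ⟨r, hr⟩ := H.even y
  have hN := fun i => dualNorm_emod_eight (fun j => B y (v i j))
  have := hN 0
  have := hN 1
  have := hN 2
  have := hN 3
  have := hN 4
  rw [Fin.sum_univ_five] at *
  -- Modulo 8 the norms sum to zero. Each odd class contributes 3 and each even one a multiple of 4,
  -- so the number of odd classes is divisible by 4.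
  omega

/-! ### Divisibility of intersections with the fiber -/

/-- The projection of `r x` to the orthogonal complement of the fiber along `h`. -/
theorem proj_apply_fiber (H : IsFiveA3Configuration B d n h v a b) {x : M} {r s : ℤ}
    (hx : r * B x (∑ j, v 0 j) = s * (4 * d)) : B (r • x - s • h) (∑ j, v 0 j) = 0 := by
  rw [map_sub, LinearMap.sub_apply, map_smul, map_smul, LinearMap.smul_apply,
    LinearMap.smul_apply, H.symm h, H.fiber_apply_h, smul_eq_mul, smul_eq_mul, hx, sub_self]

theorem proj_apply_vertex (H : IsFiveA3Configuration B d n h v a b) (x : M) (r s : ℤ) (i : Fin 5)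
    (j : Fin 4) : B (r • x - s • h) (v i j) = r * B x (v i j) - s * d := by
  simp [H.hv]

theorem proj_sq (H : IsFiveA3Configuration B d n h v a b) (x : M) (r s : ℤ) :
    B (r • x - s • h) (r • x - s • h) = r ^ 2 * B x x - 2 * (r * s * B x h) + s ^ 2 * (2 * n) := by
  simp [H.hh, H.symm h x]
  ring

/-- If the intersection were odd, the projection of `4d x` would be odd on every vertex with all
five classes equal to 2 modulo 4. The norms would then sum to 20, which is nonzero modulo 8. -/
theorem even_apply_fiber (H : IsFiveA3Configuration B d n h v a b) (hd : Odd d) (x : M) :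
    Even (B x (∑ j, v 0 j)) := by
  by_contra hodd
  rw [Int.not_even_iff_odd] at hodd
  set q := B x (∑ j, v 0 j) with hq
  have hd0 : d ≠ 0 := by
    rintro rfl
    exact absurd hd (by decide)
  have hy := H.proj_apply_fiber (x := x) (r := 4 * d) (s := q) (by rw [← hq]; ring)
  obtain ⟨q', -, -, hsq⟩ := H.exists_four_mul_sq hd0 hy
  obtain ⟨r, hr⟩ := H.even ((4 * d) • x - q • h)
  obtain ⟨c, hc⟩ := hodd.mul hd
  have hN : ∀ i, dualNorm (fun j => B ((4 * d) • x - q • h) (v i j)) % 16 = 4 := by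
    intro i
    have hodd' : ∀ j, Odd (B ((4 * d) • x - q • h) (v i j)) := by
      intro j
      rw [H.proj_apply_vertex, hc]
      exact ⟨2 * (d * B x (v i j)) - c - 1, by ring⟩
    rcases dualNorm_emod_sixteen _ hodd' with ⟨h1, -⟩ | ⟨-, h1⟩
    · simp only [discrClass, H.proj_apply_vertex, hc] at h1
      rw [show 4 * d * B x (v i 1) - (2 * c + 1) + 2 * (4 * d * B x (v i 2) - (2 * c + 1)) +
        3 * (4 * d * B x (v i 3) - (2 * c + 1)) = 4 * (d * B x (v i 1) + 2 * d * B x (v i 2) +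
        3 * d * B x (v i 3) - 3 * c - 2) + 2 by ring] at h1
      omega
    · exact h1
  have := hN 0
  have := hN 1
  have := hN 2
  have := hN 3
  have := hN 4
  rw [Fin.sum_univ_five] at hsq
  omega

/-- If the intersection were 2 modulo 4, the projection `y` of `2d x` would be odd on every vertex.
Its classes have order at most two, so zero or four of them are nonzero, and in both cases the norms
sum to 8 modulo 16. The `A₂` term is also 8 modulo 16, which forces `4 ∣ y²`; but `y²` is 2 modulo 4
since `n` is odd. -/
theorem four_dvd_apply_fiber (H : IsFiveA3Configuration B d n h v a b) (hd : Odd d) (hd0 : 0 < d)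
    (hn : Odd n) (hR : RootCondition B d h v) (x : M) : 4 ∣ B x (∑ j, v 0 j) := by
  by_contra hodd
  obtain ⟨q, hq⟩ := (H.even_apply_fiber hd x).two_dvd
  have hqo : Odd q := by
    rw [← Int.not_even_iff_odd]
    rintro ⟨r, rfl⟩
    exact hodd ⟨r, by rw [hq]; ring⟩
  have hy := H.proj_apply_fiber (x := x) (r := 2 * d) (s := q) (by rw [hq]; ring)
  set y := (2 * d) • x - q • h with hyd
  obtain ⟨q', hQ, -, hsq⟩ := H.exists_four_mul_sq hd0.ne' hy
  obtain ⟨c, hc⟩ := hqo.mul hd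
  have hodd' : ∀ i j, Odd (B y (v i j)) := by
    intro i j
    rw [hyd, H.proj_apply_vertex, hc]
    exact ⟨d * B x (v i j) - c - 1, by ring⟩
  have hN := fun i => dualNorm_emod_sixteen (fun j => B y (v i j)) (hodd' i)
  have hε : ∀ i, ∃ ε : ℤ, (ε = 0 ∨ ε = 1) ∧ 4 ∣ discrClass (fun j => B y (v i j)) - 2 * ε ∧
      dualNorm (fun j => B y (v i j)) % 16 = 8 - 4 * ε := by
    intro i
    rcases hN i with ⟨h1, h2⟩ | ⟨h1, h2⟩
    · exact ⟨0, Or.inl rfl, by omega, by omega⟩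
    · exact ⟨1, Or.inr rfl, by omega, by omega⟩
  choose ε hε hεc hεN using hε
  have hcard := H.sum_eq_zero_or_four hd0 hR hy ε hε hεc
  have hq' : Odd q' := by
    have ha : Odd (B y a) := by
      have : B y a = 2 * (d * B x a) - q * d := by simp [hyd, H.ha]; ring
      rw [this, hc]
      exact ⟨d * B x a - c - 1, by ring⟩
    have hb : Odd (B y b) := by
      have : B y b = 2 * (d * B x b) - q * d := by simp [hyd, H.hb]; ring
      rw [this, hc]
      exact ⟨d * B x b - c - 1, by ring⟩
    have : Odd (3 * q') := by
      rw [← hQ]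
      exact (ha.pow.add_odd (ha.mul hb)).add_odd hb.pow
    exact (Int.odd_mul.mp this).2
  obtain ⟨r, hr⟩ := hq'
  have hyy : B y y % 4 = 2 := by
    obtain ⟨m, hm⟩ := (hqo.pow (n := 2)).mul hn
    rw [hyd, H.proj_sq, show (2 * d) ^ 2 * B x x - 2 * (2 * d * q * B x h) + q ^ 2 * (2 * n) =
      4 * (d ^ 2 * B x x - d * q * B x h) + 2 * (q ^ 2 * n) by ring, hm]
    omega
  have := hεN 0
  have := hεN 1
  have := hεN 2
  have := hεN 3
  have := hεN 4
  have := hε 0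
  have := hε 1
  have := hε 2
  have := hε 3
  have := hε 4
  rw [Fin.sum_univ_five] at hsq hcard
  omega

/-- The discriminant classes modulo two of an arbitrary vector. -/
def word (B : LinearMap.BilinForm ℤ M) (v : Fin 5 → Fin 4 → M) :
    M →+ (Fin 5 → ZMod 2) where
  toFun x i := ((B x (v i 1) + B x (v i 3) : ℤ) : ZMod 2)
  map_zero' := by
    ext
    simp
  map_add' x y := by
    ext
    simp
    ring

theorem word_apply (x : M) (i : Fin 5) :
    word B v x i = ((B x (v i 1) + B x (v i 3) : ℤ) : ZMod 2) := rfl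

/-- Projecting `d x` along `h` multiplies the classes modulo 2 by the odd number `d`, so
`sum_emod_two` transfers to `x`. -/
theorem sum_val_word (H : IsFiveA3Configuration B d n h v a b) (hd : Odd d) (hd0 : 0 < d)
    (hn : Odd n) (hR : RootCondition B d h v) (x : M) :
    ∑ i, (word B v x i).val = 0 ∨ ∑ i, (word B v x i).val = 4 := by
  obtain ⟨q, hq⟩ := H.four_dvd_apply_fiber hd hd0 hn hR x
  have hy := H.proj_apply_fiber (x := x) (r := d) (s := q) (by rw [hq]; ring)
  have hval : ∀ i, ((word B v x i).val : ℤ) =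
      discrClass (fun j => B (d • x - q • h) (v i j)) % 2 := by
    intro i
    rw [word_apply, ZMod.val_intCast, discrClass]
    simp only [H.proj_apply_vertex]
    obtain ⟨l, hl⟩ := hd
    rw [show d * B x (v i 1) - q * d + 2 * (d * B x (v i 2) - q * d) +
      3 * (d * B x (v i 3) - q * d) = d * (B x (v i 1) + B x (v i 3)) +
      2 * (d * B x (v i 2) - 3 * (q * d) + d * B x (v i 3)) by ring, hl,
      add_mul, one_mul, mul_assoc 2 l]
    push_cast
    omega
  have := H.sum_emod_two hd0.ne' hy
  simp only [← hval] at this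
  exact_mod_cast this

/-- A binary code of length five with all weights zero or four is at most one-dimensional. -/
theorem exists_eq_zero_or_eq {s : Set (Fin 5 → ZMod 2)} (hadd : ∀ x ∈ s, ∀ y ∈ s, x + y ∈ s)
    (hs : ∀ x ∈ s, ∑ i, (x i).val = 0 ∨ ∑ i, (x i).val = 4) :
    ∃ w, ∀ x ∈ s, x = 0 ∨ x = w := by
  -- Two distinct words of weight four in length five differ by a word of weight two.
  have key : ∀ x y : Fin 5 → ZMod 2, (∑ i, (x i).val = 0 ∨ ∑ i, (x i).val = 4) →
      (∑ i, (y i).val = 0 ∨ ∑ i, (y i).val = 4) →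
      (∑ i, ((x + y) i).val = 0 ∨ ∑ i, ((x + y) i).val = 4) → x = 0 ∨ y = 0 ∨ y = x := by
    decide +kernel
  by_cases h : ∃ x ∈ s, x ≠ 0
  · obtain ⟨x, hx, hx0⟩ := h
    exact ⟨x, fun y hy => (key x y (hs x hx) (hs y hy) (hs _ (hadd x hx y hy))).resolve_left hx0⟩
  · push Not at h
    exact ⟨0, fun x hx => Or.inl (h x hx)⟩

end IsFiveA3Configuration

/-! ### Primitive sublattices modulo two -/

/-- Reduction modulo two of integral vectors. -/
def reduceModTwo (ι : Type*) : (ι → ℤ) →+ (ι → ZMod 2) := (Int.castAddHom (ZMod 2)).compLeft ι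

theorem reduceModTwo_apply {ι : Type*} (x : ι → ℤ) (i : ι) :
    reduceModTwo ι x i = (x i : ZMod 2) := rfl

theorem reduceModTwo_smul {ι : Type*} (c : ℤ) (x : ι → ℤ) :
    reduceModTwo ι (c • x) = (c : ZMod 2) • reduceModTwo ι x := by
  ext i
  simp [reduceModTwo_apply]

theorem exists_eq_two_smul_of_reduceModTwo_eq_zero {ι : Type*} {x : ι → ℤ}
    (hx : reduceModTwo ι x = 0) : ∃ y, x = (2 : ℤ) • y := by
  have : ∀ i, (2 : ℤ) ∣ x i := fun i =>
    (ZMod.intCast_zmod_eq_zero_iff_dvd (x i) 2).mp (congrFun hx i)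
  choose y hy using this
  exact ⟨y, funext hy⟩

theorem toBilin'_reduceModTwo {ι : Type*} [Fintype ι] [DecidableEq ι] (A : Matrix ι ι ℤ)
    (x y : ι → ℤ) : Matrix.toBilin' (A.map (Int.cast : ℤ → ZMod 2)) (reduceModTwo ι x)
      (reduceModTwo ι y) = ((Matrix.toBilin' A x y : ℤ) : ZMod 2) := by
  simp [Matrix.toBilin'_apply, reduceModTwo_apply]

/-- A subgroup is linearly independent modulo two if it is primitive at two. -/
theorem finrank_le_finrank_span_reduceModTwo {ι M : Type*} [Fintype ι] [AddCommGroup M]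
    [Module.Free ℤ M] [Module.Finite ℤ M] {f : M →ₗ[ℤ] (ι → ℤ)} (hf : Function.Injective f)
    (hp : ∀ y, (2 : ℤ) • y ∈ LinearMap.range f → y ∈ LinearMap.range f) :
    finrank ℤ M ≤ finrank (ZMod 2)
      (Submodule.span (ZMod 2) (Set.range fun x => reduceModTwo ι (f x))) := by
  let b := Module.finBasis ℤ M
  -- A relation modulo 2 lifts to an element of `M` whose image is divisible by 2; by primitivity
  -- the element itself is, so its coefficients are even.
  have hli : LinearIndependent (ZMod 2) fun i => reduceModTwo ι (f (b i)) := by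
    rw [Fintype.linearIndependent_iff]
    intro g hg
    choose c hc using fun i => ZMod.intCast_surjective (n := 2) (g i)
    have h0 : reduceModTwo ι (f (∑ i, c i • b i)) = 0 := by
      rw [← hg, map_sum, map_sum]
      refine Finset.sum_congr rfl fun i _ => ?_
      ext j
      simp [reduceModTwo_apply, hc]
    obtain ⟨z, hz⟩ := exists_eq_two_smul_of_reduceModTwo_eq_zero h0
    obtain ⟨y, rfl⟩ := hp z ⟨_, hz⟩
    rw [← map_smul] at hz
    have hy := hf hz
    intro i
    have hr := congrArg (fun x => b.repr x i) hy
    simp only [b.repr_sum_self, map_smul, Finsupp.smul_apply, smul_eq_mul] at hr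
    rw [← hc, hr]
    push_cast
    rw [show (2 : ZMod 2) = 0 from rfl, zero_mul]
  have h1 := finrank_span_eq_card hli
  rw [Fintype.card_fin] at h1
  rw [← h1]
  refine Submodule.finrank_mono (Submodule.span_mono ?_)
  rintro _ ⟨i, rfl⟩
  exact ⟨b i, rfl⟩

/-- The radical modulo two of a primitive sublattice of a unimodular lattice is bounded by the
corank. -/
theorem finrank_add_finrank_le_of_orthogonal {ι M : Type*} [Fintype ι] [DecidableEq ι]
    [AddCommGroup M] [Module.Free ℤ M] [Module.Finite ℤ M] {A : Matrix ι ι ℤ}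
    (hA : (A.det : ZMod 2) ≠ 0) {f : M →ₗ[ℤ] (ι → ℤ)} (hf : Function.Injective f)
    (hp : ∀ y, (2 : ℤ) • y ∈ LinearMap.range f → y ∈ LinearMap.range f)
    (U : Submodule (ZMod 2) (ι → ZMod 2))
    (hU : ∀ x, ∀ u ∈ U, Matrix.toBilin' (A.map (Int.cast : ℤ → ZMod 2))
      (reduceModTwo ι (f x)) u = 0) :
    finrank ℤ M + finrank (ZMod 2) U ≤ Fintype.card ι := by
  set C := Matrix.toBilin' (A.map (Int.cast : ℤ → ZMod 2)) with hC
  have hn : C.Nondegenerate := by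
    refine LinearMap.BilinForm.nondegenerate_toBilin'_of_det_ne_zero' _ ?_
    rw [Int.cast_det] at hA
    exact hA
  set W := Submodule.span (ZMod 2) (Set.range fun x => reduceModTwo ι (f x))
  have hle : U ≤ C.orthogonal W := by
    intro u hu w hw
    induction hw using Submodule.span_induction with
    | mem w hw =>
      obtain ⟨x, rfl⟩ := hw
      exact hU x u hu
    | zero => simp
    | add x y _ _ hx hy =>
      simp only [map_add, LinearMap.add_apply] at *
      rw [hx, hy, add_zero]
    | smul c x _ hx =>
      simp only [map_smul, LinearMap.smul_apply] at *
      rw [hx, smul_zero]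
  have h1 := Submodule.finrank_mono hle
  rw [LinearMap.BilinForm.finrank_orthogonal hn, finrank_fintype_fun_eq_card] at h1
  have h2 := finrank_le_finrank_span_reduceModTwo hf hp
  have h3 := Submodule.finrank_le W
  rw [finrank_fintype_fun_eq_card] at h3
  change finrank ℤ M ≤ finrank (ZMod 2) W at h2
  omega

/-! ### The dimension count -/

namespace IsFiveA3Configuration

variable {M : Type*} [AddCommGroup M] {B : LinearMap.BilinForm ℤ M} {d n : ℤ} {h : M}
  {v : Fin 5 → Fin 4 → M} {a b : M}

/-- Three vertices per fiber, `a`, `b`, the fiber class and `h` are independent: in a relation,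
pairing with the fiber kills the coefficient of `h`, the non-degeneracy of `A₃` and `A₂` kills those
of the vertices, and the degree kills the last one. -/
theorem nineteen_le_finrank [Module.Free ℤ M] [Module.Finite ℤ M]
    (H : IsFiveA3Configuration B d n h v a b) (hd : d ≠ 0) : 19 ≤ finrank ℤ M := by
  let g : (Fin 5 × Fin 3 → ℤ) × (Fin 4 → ℤ) →ₗ[ℤ] M :=
    (Fintype.linearCombination ℤ fun ij : Fin 5 × Fin 3 => v ij.1 ij.2.succ).coprod
      (Fintype.linearCombination ℤ ![a, b, ∑ j, v 0 j, h])
  have hg : ∀ x, g x = comb v a b (fun i => ![0, x.1 (i, 0), x.1 (i, 1), x.1 (i, 2)])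
      (x.2 0) (x.2 1) + x.2 2 • (∑ j, v 0 j) + x.2 3 • h := by
    intro x
    simp only [g, LinearMap.coprod_apply, Fintype.linearCombination_apply, comb,
      Fintype.sum_prod_type, Fin.sum_univ_four, Fin.sum_univ_three]
    simp
    abel
  have hinj : Function.Injective g := by
    rw [← LinearMap.ker_eq_bot, LinearMap.ker_eq_bot']
    intro x hx
    rw [hg] at hx
    have hB : ∀ y, B (comb v a b (fun i => ![0, x.1 (i, 0), x.1 (i, 1), x.1 (i, 2)])
        (x.2 0) (x.2 1)) y + x.2 2 * B (∑ j, v 0 j) y + x.2 3 * B h y = 0 := by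
      intro y
      have := congrArg (fun z => B z y) hx
      simpa only [map_add, LinearMap.add_apply, map_smul, LinearMap.smul_apply, smul_eq_mul,
        map_zero, LinearMap.zero_apply] using this
    have h3 : x.2 3 = 0 := by
      have := hB (∑ j, v 0 j)
      rw [H.comb_apply_fiber, H.fiber_apply_fiber, H.symm h, H.fiber_apply_h] at this
      simpa [hd] using this
    have hv : ∀ i, x.1 (i, 0) = 0 ∧ x.1 (i, 1) = 0 ∧ x.1 (i, 2) = 0 := by
      intro i
      have h4 := hB (v i 1)
      have h5 := hB (v i 2)
      have h6 := hB (v i 3)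
      rw [H.comb_apply_vertex, H.fiber_apply_vertex, h3] at h4 h5 h6
      simp at h4 h5 h6
      omega
    have ha := hB a
    have hb := hB b
    rw [H.comb_apply_a, H.fiber_apply_a, h3] at ha
    rw [H.comb_apply_b, H.fiber_apply_b, h3] at hb
    have h0 : x.2 0 = 0 := by omega
    have h1 : x.2 1 = 0 := by omega
    have h2 : x.2 2 = 0 := by
      have := hB h
      rw [h3, H.fiber_apply_h, H.symm _ h, apply_comb] at this
      simpa [h0, h1, Fin.sum_univ_four, hv, hd] using this
    refine Prod.ext ?_ ?_
    · ext ⟨i, j⟩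
      fin_cases j
      exacts [(hv i).1, (hv i).2.1, (hv i).2.2]
    · ext j
      fin_cases j
      exacts [h0, h1, h2, h3]
  have := LinearMap.finrank_le_finrank_of_injective hinj
  simpa using this

theorem no_primitive_embedding [Module.Free ℤ M] [Module.Finite ℤ M]
    (H : IsFiveA3Configuration B d n h v a b) (hd : Odd d) (hd0 : 0 < d) (hn : Odd n)
    (hR : RootCondition B d h v) {ι : Type*} [Fintype ι] [DecidableEq ι]
    (hι : Fintype.card ι ≤ 22) {A : Matrix ι ι ℤ} (hA : (A.det : ZMod 2) ≠ 0)
    {f : M →ₗ[ℤ] (ι → ℤ)} (hf : Function.Injective f)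
    (hB : ∀ x y, Matrix.toBilin' A (f x) (f y) = B x y)
    (hp : ∀ y, (2 : ℤ) • y ∈ LinearMap.range f → y ∈ LinearMap.range f) : False := by
  obtain ⟨w, hw⟩ := exists_eq_zero_or_eq (s := Set.range (word B v))
    (by rintro _ ⟨x, rfl⟩ _ ⟨y, rfl⟩; exact ⟨x + y, map_add _ _ _⟩)
    (by rintro _ ⟨x, rfl⟩; exact H.sum_val_word hd hd0 hn hR x)
  -- `Φ` spans the six candidates for the radical modulo 2. Pairing `x` with its value gives the dot
  -- product with `word B v x`, as the fiber contributes an even number; since every word is 0 or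
  -- `w`, the kernel of `ℓ` maps into the orthogonal complement.
  let Φ : (Fin 5 → ZMod 2) × ZMod 2 →ₗ[ZMod 2] (ι → ZMod 2) :=
    (Fintype.linearCombination (ZMod 2) fun i => reduceModTwo ι (f (v i 1 + v i 3))).coprod
      (LinearMap.toSpanSingleton (ZMod 2) _ (reduceModTwo ι (f (∑ j, v 0 j))))
  have hΦ : ∀ x, Φ x = ∑ i, x.1 i • reduceModTwo ι (f (v i 1 + v i 3)) +
      x.2 • reduceModTwo ι (f (∑ j, v 0 j)) := by
    intro x
    simp only [Φ, LinearMap.coprod_apply, Fintype.linearCombination_apply,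
      LinearMap.toSpanSingleton_apply]
  let ℓ : (Fin 5 → ZMod 2) × ZMod 2 →ₗ[ZMod 2] ZMod 2 :=
    (Fintype.linearCombination (ZMod 2) w).comp (LinearMap.fst _ _ _)
  have hbound := finrank_add_finrank_le_of_orthogonal hA hf hp
    (LinearMap.range (Φ.domRestrict (LinearMap.ker ℓ))) (by
      rintro x _ ⟨⟨u, hu⟩, rfl⟩
      have hu' : ∑ i, u.1 i * w i = 0 := by
        simpa [ℓ, Fintype.linearCombination_apply] using hu
      obtain ⟨q, hq⟩ := H.four_dvd_apply_fiber hd hd0 hn hR x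
      have hword : ∑ i, u.1 i * word B v x i = 0 := by
        rcases hw _ ⟨x, rfl⟩ with h0 | h0 <;> rw [h0]
        · simp
        · exact hu'
      rw [LinearMap.domRestrict_apply, hΦ, map_add, map_smul, toBilin'_reduceModTwo, hB, hq,
        map_sum]
      simp only [map_smul (Matrix.toBilin' _ _), toBilin'_reduceModTwo, hB, smul_eq_mul]
      simp only [map_add, ← word_apply, hword]
      push_cast
      rw [show (4 : ZMod 2) = 0 from rfl, zero_mul, mul_zero, add_zero])
  -- By primitivity an element of the kernel of `Φ` gives `y` with `2 y` equal to its integral lift.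
  -- Such a `y` is orthogonal to the fiber with classes `2 ε`, so the weight is zero or four; weight
  -- zero leaves only the fiber, which is not divisible by 2.
  have hker : finrank (ZMod 2) (LinearMap.ker (Φ.domRestrict (LinearMap.ker ℓ))) ≤ 1 := by
    have hΦker : ∀ x, Φ x = 0 → ∃ y : M, (2 : ℤ) • y =
        comb v a b (fun i => ![0, (x.1 i).val, 0, (x.1 i).val]) 0 0 +
          (x.2.val : ℤ) • ∑ j, v 0 j := by
      intro x hx
      have h0 : reduceModTwo ι (f (comb v a b (fun i => ![0, (x.1 i).val, 0, (x.1 i).val]) 0 0 +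
          (x.2.val : ℤ) • ∑ j, v 0 j)) = 0 := by
        rw [← hx, hΦ, map_add, map_add, map_smul, reduceModTwo_smul, comb, zero_smul, zero_smul,
          add_zero, add_zero, map_sum, map_sum, Int.cast_natCast, ZMod.natCast_zmod_val]
        congr 1
        refine Finset.sum_congr rfl fun i _ => ?_
        rw [Fin.sum_univ_four]
        simp only [Matrix.cons_val_zero, Matrix.cons_val_one, Matrix.cons_val, zero_smul, zero_add,
          add_zero]
        rw [← smul_add, map_smul, reduceModTwo_smul, Int.cast_natCast, ZMod.natCast_zmod_val]
      obtain ⟨z, hz⟩ := exists_eq_two_smul_of_reduceModTwo_eq_zero h0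
      obtain ⟨y, rfl⟩ := hp z ⟨_, hz⟩
      rw [← map_smul] at hz
      exact ⟨y, (hf hz).symm⟩
    have hwt : ∀ x, Φ x = 0 → ∑ i, (x.1 i).val = 0 ∨ ∑ i, (x.1 i).val = 4 := by
      intro x hx
      obtain ⟨y, hy⟩ := hΦker x hx
      have hyB := fun t => congrArg (fun z => B z t) hy
      simp only [map_add, LinearMap.add_apply, map_smul, LinearMap.smul_apply, smul_eq_mul] at hyB
      have hyk : B y (∑ j, v 0 j) = 0 := by
        have := hyB (∑ j, v 0 j)
        rw [H.comb_apply_fiber, H.fiber_apply_fiber] at this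
        omega
      have := H.sum_eq_zero_or_four hd0 hR hyk (fun i => ((x.1 i).val : ℤ))
        (fun i => by have := ZMod.val_lt (x.1 i); omega) (fun i => by
          have h1 := hyB (v i 1)
          have h2 := hyB (v i 2)
          have h3 := hyB (v i 3)
          rw [H.comb_apply_vertex, H.fiber_apply_vertex] at h1 h2 h3
          simp [-ZMod.natCast_val] at h1 h2 h3
          simp only [discrClass]
          omega)
      exact_mod_cast this
    have hfst : ∀ x, Φ x = 0 → x.1 = 0 → x = 0 := by
      intro x hx hx1
      obtain ⟨y, hy⟩ := hΦker x hx
      refine Prod.ext hx1 ?_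
      have hlt := ZMod.val_lt x.2
      by_contra hne
      have h1 : x.2.val = 1 := by
        have : x.2.val ≠ 0 := fun h0 => hne ((ZMod.val_eq_zero x.2).mp h0)
        omega
      refine H.ne_two_smul_fiber hd0 hR y ?_
      rw [hy, h1, hx1]
      simp [comb, Fin.sum_univ_four]
    obtain ⟨g, hg⟩ := exists_eq_zero_or_eq (s := {ε | ∃ δ, Φ (ε, δ) = 0})
      (by
        rintro x ⟨δ, hx⟩ y ⟨δ', hy⟩
        exact ⟨δ + δ', by rw [← Prod.mk_add_mk, map_add, hx, hy, add_zero]⟩)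
      (by rintro x ⟨δ, hx⟩; exact hwt _ hx)
    have hinj : ∀ x y, Φ x = 0 → Φ y = 0 → y ≠ 0 → x = 0 ∨ x = y := by
      intro x y hx hy hy0
      have hyg := (hg y.1 ⟨y.2, hy⟩).resolve_left fun h0 => hy0 (hfst y hy h0)
      rcases hg x.1 ⟨x.2, hx⟩ with h0 | h0
      · exact Or.inl (hfst x hx h0)
      · refine Or.inr (sub_eq_zero.mp (hfst _ (by rw [map_sub, hx, hy, sub_zero]) ?_))
        rw [Prod.fst_sub, h0, hyg, sub_self]
    have hmem : ∀ x : LinearMap.ker (Φ.domRestrict (LinearMap.ker ℓ)), Φ x = 0 := fun x => x.2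
    by_cases hall : ∀ x : LinearMap.ker (Φ.domRestrict (LinearMap.ker ℓ)), x = 0
    · exact finrank_le_one 0 fun x => ⟨0, by rw [hall x, smul_zero]⟩
    · push Not at hall
      obtain ⟨y, hy0⟩ := hall
      refine finrank_le_one y fun x => ?_
      rcases hinj _ _ (hmem x) (hmem y) (by simpa using hy0) with h0 | h0
      · exact ⟨0, by rw [zero_smul]; exact (Subtype.ext (Subtype.ext h0)).symm⟩
      · exact ⟨1, by rw [one_smul]; exact (Subtype.ext (Subtype.ext h0)).symm⟩
  -- The kernel of `ℓ` has dimension at least 5, so its image under `Φ` has dimension at least 4,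
  -- and `19 + 4 > 22`.
  have h1 := LinearMap.finrank_range_add_finrank_ker (Φ.domRestrict (LinearMap.ker ℓ))
  have h2 := LinearMap.finrank_range_add_finrank_ker ℓ
  have h3 := Submodule.finrank_le (LinearMap.range ℓ)
  have h4 := H.nineteen_le_finrank hd0.ne'
  simp only [finrank_prod, finrank_fintype_fun_eq_card, Fintype.card_fin, finrank_self] at h2 h3
  omega

end IsFiveA3Configuration

end

/-! ### Application to the lattice of the graph -/

theorem EvenLattice.k3Gram_det : EvenLattice.k3Gram.det = -1 := by
  rw [EvenLattice.k3Gram, Matrix.det_fromBlocks_zero₂₁, Matrix.det_blockDiagonal,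
    Matrix.det_blockDiagonal]
  simp [Matrix.det_neg, CartanMatrix.E₈_det, Matrix.det_fin_two]

namespace Multigraph

theorem gram_inl_inl (n d : ℕ) (i i' : Fin 5) (j j' : Fin 4) :
    fiveAffineA3PlusA2.gram n d (some (.inl (i, j))) (some (.inl (i', j'))) =
      if i = i' then (if j = j' then -2 else if j = j' + 2 then 0 else 1) else 0 := by
  have key : ∀ (i i' : Fin 5) (j j' : Fin 4),
      (if (Sum.inl (i, j) : Fin 5 × Fin 4 ⊕ Fin 2) = Sum.inl (i', j') then -2 else
        ((if i = i' then (if (SimpleGraph.cycleGraph 4).Adj j j' then 1 else 0) else 0 : ℕ) : ℤ)) =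
        if i = i' then (if j = j' then -2 else if j = j' + 2 then 0 else 1) else 0 := by
    decide
  exact key i i' j j'

theorem gram_inl_inr (n d : ℕ) (ij : Fin 5 × Fin 4) (s : Fin 2) :
    fiveAffineA3PlusA2.gram n d (some (.inl ij)) (some (.inr s)) = 0 := rfl

theorem gram_inr_inr (n d : ℕ) (s t : Fin 2) :
    fiveAffineA3PlusA2.gram n d (some (.inr s)) (some (.inr t)) = if s = t then -2 else 1 := by
  have key : ∀ s t : Fin 2, (if (Sum.inr s : Fin 5 × Fin 4 ⊕ Fin 2) = Sum.inr t then -2 else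
      ((if (⊤ : SimpleGraph (Fin 2)).Adj s t then 1 else 0 : ℕ) : ℤ)) =
        if s = t then -2 else 1 := by
    decide
  exact key s t

theorem fano_form_fanoVec (Γ : Multigraph) (n d : ℕ) (i j : Option Γ.V) :
    (Γ.fano n d).form (Γ.fanoVec n d i) (Γ.fanoVec n d j) = Γ.gram n d i j :=
  Matrix.toBilin'_single (Γ.gram n d) i j

theorem span_fanoVec (Γ : Multigraph) (n d : ℕ) :
    Submodule.span ℤ (Set.range (Γ.fanoVec n d)) = ⊤ := by
  let q : (Option Γ.V → ℤ) →ₗ[ℤ] Γ.fano n d := (Γ.preFano n d).radical.mkQ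
  have hq : LinearMap.range q = ⊤ := Submodule.range_mkQ _
  rw [← hq, LinearMap.range_eq_map, ← (Pi.basisFun ℤ (Option Γ.V)).span_eq, Submodule.map_span,
    ← Set.range_comp]
  congr 2
  ext i
  rw [Function.comp_apply, Pi.basisFun_apply]
  rfl

end Multigraph

open Multigraph in
theorem IsFiveA3Configuration.of_finiteIndexExtension {n d : ℕ} {S : EvenLattice}
    {f : fiveAffineA3PlusA2.fano n d →ₗ[ℤ] S} (hf : EvenLattice.IsFiniteIndexExtension f)
    (hS : S.form.Nondegenerate) :
    IsFiveA3Configuration S.form d n (f (fiveAffineA3PlusA2.fanoH n d))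
      (fun i j => f (fiveAffineA3PlusA2.fanoVec n d (some (.inl (i, j)))))
      (f (fiveAffineA3PlusA2.fanoVec n d (some (.inr (0 : Fin 2)))))
      (f (fiveAffineA3PlusA2.fanoVec n d (some (.inr (1 : Fin 2))))) where
  symm := S.symm
  even := S.even
  hh := by rw [hf.isometry]; exact fano_form_fanoVec _ _ _ _ _
  hv i j := by rw [hf.isometry]; exact fano_form_fanoVec _ _ _ _ _
  ha := by rw [hf.isometry]; exact fano_form_fanoVec _ _ _ _ _
  hb := by rw [hf.isometry]; exact fano_form_fanoVec _ _ _ _ _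
  vv i j i' j' := by rw [hf.isometry, fano_form_fanoVec]; exact gram_inl_inl n d i i' j j'
  va i j := by rw [hf.isometry, fano_form_fanoVec]; exact gram_inl_inr n d (i, j) 0
  vb i j := by rw [hf.isometry, fano_form_fanoVec]; exact gram_inl_inr n d (i, j) 1
  aa := by rw [hf.isometry, fano_form_fanoVec]; exact gram_inr_inr n d 0 0
  bb := by rw [hf.isometry, fano_form_fanoVec]; exact gram_inr_inr n d 1 1
  ab := by rw [hf.isometry, fano_form_fanoVec]; exact gram_inr_inr n d 0 1
  ext x hxh hxv hxa hxb := by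
    have hgen : ∀ i, S.form x (f (fiveAffineA3PlusA2.fanoVec n d i)) = 0 := by
      rintro (_ | ⟨i, j⟩ | s)
      · exact hxh
      · exact hxv i j
      · change Fin 2 at s
        fin_cases s
        exacts [hxa, hxb]
    have hrange : ∀ y, S.form x (f y) = 0 := by
      have hle : Submodule.span ℤ (Set.range (fiveAffineA3PlusA2.fanoVec n d)) ≤
          LinearMap.ker ((S.form x).comp f) := by
        rw [Submodule.span_le]
        rintro _ ⟨i, rfl⟩
        exact hgen i
      intro y
      exact hle (span_fanoVec fiveAffineA3PlusA2 n d ▸ Submodule.mem_top)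
    -- A multiple of every vector by the index lies in the image of `f`, so orthogonality to the
    -- image implies orthogonality to `S`.
    have := hf.finiteIndex
    refine hS.1 x fun y => ?_
    have hmem := (LinearMap.range f).toAddSubgroup.nsmul_index_mem y
    obtain ⟨z, hz⟩ := hmem
    have h0 := hrange z
    rw [hz, map_nsmul, smul_eq_zero] at h0
    exact h0.resolve_left this.index_ne_zero

theorem mainTheorem11 (d : ℕ) (hd : Odd d) (hd1 : 1 < d) :
    ∃ N : ℕ, ∀ n : ℕ, N ≤ n → Odd n →
      ¬ Multigraph.fiveAffineA3PlusA2.IsSubgeometric n d := by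
  -- The argument is uniform in odd `n`, so zero serves as the bound.
  refine ⟨0, fun n _ hn => ?_⟩
  rintro ⟨-, S, f, hf, hS⟩
  obtain ⟨g, hg⟩ := hS.geometric.embeds
  have H := IsFiveA3Configuration.of_finiteIndexExtension hf
    hS.geometric.admissible.polarized.nondegenerate
  refine H.no_primitive_embedding (by exact_mod_cast hd) (by omega) (by exact_mod_cast hn) ?_
    (ι := (Fin 8 × Fin 2) ⊕ (Fin 2 × Fin 3)) (by simp) (A := EvenLattice.k3Gram)
    (by rw [EvenLattice.k3Gram_det]; decide) (f := g) hg.injective hg.isometry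
    (fun y hy => hg.primitive 2 y two_ne_zero hy)
  -- The root condition: degree zero would make `e` an exceptional divisor, and a negative
  -- intersection in degree `1 ≤ r < d` would make it inadmissible.
  intro e he he0 hed
  have hne := fun h0 => hS.geometric.admissible.no_exceptional ⟨e, he, h0⟩
  refine ⟨hne, fun i j => ?_⟩
  obtain ⟨r, hr⟩ := Int.eq_ofNat_of_zero_le he0
  by_contra! hlt
  rw [hr] at hne hed
  exact hS.no_inadmissible r (Nat.one_le_iff_ne_zero.mpr fun h0 => hne (by simp [h0]))
    (Int.ofNat_lt.mp hed)
    ⟨e, ⟨he, hr⟩, _, ⟨_, ⟨.inl (i, j), rfl⟩, rfl⟩, hlt⟩
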